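/- A \emph{complete $n$-partite directed graph} is a directed graph $G$ (a set with an asymmetric, hence irreflexive, binary relation $E$) in which the non-edge relation $x\perp y :\Leftrightarrow \neg E(x,y)\wedge\neg E(y,x)$ is an equivalence relation with at most $n$ classes, called the parts of $G$. For $n\in\mathbb{N}$, let $n*I_\omega$ denote the Fraïssé limit of the class of finite complete $n$-partite directed graphs; it has exactly $n$ parts. Let $n*I_\omega^{*}$ be an expansion of $n*I_\omega$ by unary relations $P_0,\dots,P_{n-1}$, which enumerate the parts of $n*I_\omega$ bijectively, and by a linear ordering $<$ that is convex (each part is an interval) and satisfies $P_0<P_1<\dots<P_{n-1}$. The age of a relational structure is the class of finite structures that embed in it. \textbf{Theorem.} For every $n\in\mathbb{N}$, the class $\mathrm{Age}(n*I_\omega^{*})$ has the expansion property relative to $\mathrm{Age}(n*I_\omega)$: for every $\mathbf{A}\in\mathrm{Age}(n*I_\omega)$ there is $\mathbf{B}\in\mathrm{Age}(n*I_\omega)$ such that for all $\mathbf{A}^{*},\mathbf{B}^{*}\in\mathrm{Age}(n*I_\omega^{*})$ whose reducts to the language $\{E\}$ are $\mathbf{A}$ and $\mathbf{B}$ respectively,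 $\mathbf{A}^{*}$ embeds in $\mathbf{B}^{*}$. -/

import Mathlib

open FirstOrder FirstOrder.Language FirstOrder.Language.Structure CategoryTheory

universe u v u' v' w w'

namespace PartiteExpansion

/-! ### Expansions of structures and the expansion property -/

/-- The expansion property of a class `Kstar` of `L'`-structures relative to a class `K` of
`L`-structures, where `L'` extends `L` along `φ`. For every `A` in `K` there is `B` in `K` such that
every expansion of `A` in `Kstar` embeds in every expansion of `B` in `Kstar`. An expansion of `A`
is an `L'`-structure on the universe of `A` whose reduct to `L` is `A` itself. -/
def HasExpansionProperty {L : FirstOrder.Language.{u, v}} {L' : FirstOrder.Language.{u', v'}} (φ : L →ᴸ L')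
    (Kstar : Set (Bundled.{w} L'.Structure)) (K : Set (Bundled.{w} L.Structure)) : Prop :=
  ∀ A ∈ K, ∃ B ∈ K, ∀ (sA : L'.Structure A) (sB : L'.Structure B),
    φ.IsExpansionOn A → φ.IsExpansionOn B →
    (⟨A, sA⟩ : Bundled L'.Structure) ∈ Kstar → (⟨B, sB⟩ : Bundled L'.Structure) ∈ Kstar →
    Nonempty (A ↪[L'] B)

/-! ### Complete `n`-partite directed graphs -/

section Digraph

variable {G : Type w} [Language.graph.Structure G]

/-- `Edge x y`: the pair `(x, y)` is a directed edge. The language of directed graphs is the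
language with a single binary relation symbol. -/
def Edge (x y : G) : Prop := RelMap adj ![x, y]

/-- The non-edge relation `⊥`: there is no edge between `x` and `y` in either direction. -/
def Perp (x y : G) : Prop := ¬ Edge x y ∧ ¬ Edge y x

variable (G) in
/-- `G` is a complete `n`-partite directed graph: its edge relation is asymmetric (hence
irreflexive), and the non-edge relation is an equivalence relation with at most `n` classes. -/
structure IsCompletePartite (n : ℕ) : Prop where
  asymm : ∀ x y : G, Edge x y → ¬ Edge y x
  equivalence : Equivalence (Perp (G := G))
  card_le : ENat.card (Quotient (Setoid.mk (Perp (G := G)) equivalence)) ≤ n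

end Digraph

/-- The class of finite complete `n`-partite directed graphs. -/
def completePartiteClass (n : ℕ) : Set (Bundled.{w} Language.graph.Structure) :=
  {G | Finite G ∧ IsCompletePartite G n}

/-! ### The expansion by unary part predicates and a convex linear order -/

/-- Relation symbols: unary symbols `P i` for `i : Fin n`, and a binary symbol `lt`. -/
inductive PartOrderRel (n : ℕ) : ℕ → Type
  | P (i : Fin n) : PartOrderRel n 1
  | lt : PartOrderRel n 2

/-- The language `{P 0, …, P (n - 1), <}` of the symbols that are added. -/
def partOrder (n : ℕ) : FirstOrder.Language.{0, 0} := ⟨fun _ => Empty, PartOrderRel n⟩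


/-- The interpretation of the unary symbol `P i`. -/
def partSet {n : ℕ} (F : Type w) [(partOrder n).Structure F] (i : Fin n) : Set F :=
  {x | RelMap (L := partOrder n) (PartOrderRel.P i) ![x]}

/-- The interpretation of the binary symbol `<`. -/
def orderRel (n : ℕ) {F : Type w} [(partOrder n).Structure F] (x y : F) : Prop :=
  RelMap (L := partOrder n) PartOrderRel.lt ![x, y]

/-- The relations `P 0, …, P (n - 1), <` on the directed graph `F` consist of an enumeration of
the parts (the `⊥`-classes) of `F` and a linear order on `F` that is convex (each part is an
interval) and satisfies `P 0 < ⋯ < P (n - 1)`. -/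
structure IsConvexPartExpansion (n : ℕ) (F : Type w) [Language.graph.Structure F]
    [(partOrder n).Structure F] : Prop where
  parts : Set.BijOn (partSet (n := n) F) Set.univ {C | ∃ x : F, C = {y | Perp x y}}
  linear : IsStrictTotalOrder F (orderRel n)
  convex : ∀ x y z : F, orderRel n x y → orderRel n y z → Perp x z → Perp x y
  parts_lt : ∀ i j : Fin n, i < j → ∀ x ∈ partSet F i, ∀ y ∈ partSet F j, orderRel n x y

/-! ### The Fraïssé limit and its expansion exist -/

theorem IsCompletePartite.exists_part {G : Type w} [Language.graph.Structure G] {n : ℕ}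
    (h : IsCompletePartite G n) : ∃ p : G → Fin n, ∀ x y, p x = p y ↔ Perp x y := by
  set s : Setoid G := Setoid.mk Perp h.equivalence with hs
  have hc : ENat.card (Quotient s) ≤ n := h.card_le
  have hfin : Finite (Quotient s) := by
    by_contra hinf
    rw [not_finite_iff_infinite] at hinf
    rw [ENat.card_eq_top_of_infinite] at hc
    exact absurd hc (by simp)
  have hc' : Nat.card (Quotient s) ≤ n := by
    rw [ENat.card_eq_coe_natCard] at hc
    exact_mod_cast hc
  let e := (Finite.equivFin (Quotient s)).toEmbedding.trans (Fin.castLEEmb hc')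
  refine ⟨fun x => e (Quotient.mk s x), fun x y => ?_⟩
  rw [e.injective.eq_iff, Quotient.eq]
  rfl

theorem IsCompletePartite.of_part {G : Type w} [Language.graph.Structure G] {n : ℕ}
    (ha : ∀ x y : G, Edge x y → ¬ Edge y x) (p : G → Fin n)
    (hp : ∀ x y, p x = p y ↔ Perp x y) : IsCompletePartite G n where
  asymm := ha
  equivalence := ⟨fun x => (hp x x).1 rfl, fun h => (hp _ _).1 ((hp _ _).2 h).symm,
    fun h h' => (hp _ _).1 (((hp _ _).2 h).trans ((hp _ _).2 h'))⟩
  card_le := by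
    refine (ENat.card_le_card_of_injective (β := Fin n)
      (f := Quotient.lift p fun a b hab => (hp a b).2 hab) ?_).trans (by simp)
    intro a b
    induction a using Quotient.inductionOn
    induction b using Quotient.inductionOn
    intro hab
    exact Quotient.sound ((hp _ _).1 hab)

theorem edge_map_iff {G : Type w} {H : Type w'} [Language.graph.Structure G]
    [Language.graph.Structure H] (f : G ↪[Language.graph] H) (x y : G) :
    Edge (f x) (f y) ↔ Edge x y := by
  have := f.map_rel adj ![x, y]
  rw [Edge, Edge, ← this]
  apply iff_of_eq
  congr 1
  funext i
  fin_cases i <;> rfl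

theorem edge_coe_iff {G : Type w} [Language.graph.Structure G]
    (S : Language.graph.Substructure G) (x y : S) : Edge (x : G) (y : G) ↔ Edge x y :=
  edge_map_iff S.subtype x y

/-- A one-point extension criterion for embeddings of complete partite directed graphs. -/
theorem isExtensionPair_of_extension {n : ℕ} {G : Type w} {H : Type w'}
    [Language.graph.Structure G] [Language.graph.Structure H]
    (hG : IsCompletePartite G n) (hH : ∀ x y : H, Edge x y → ¬ Edge y x) (q : H → Fin n)
    (hq : ∀ x y, q x = q y ↔ Perp x y)
    (hext : ∀ (S : Set H), S.Finite → ∀ (f : H → Prop) (i : Fin n), ∃ z, z ∉ S ∧ q z = i ∧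
      ∀ s ∈ S, q s ≠ i → (Edge z s ↔ f s)) :
    Language.graph.IsExtensionPair G H := by
  classical
  obtain ⟨p, hp⟩ := hG.exists_part
  rw [isExtensionPair_iff_exists_embedding_closure_singleton_sup]
  intro S hS f m
  have hSfin : Finite S := hS.finite
  have hpq : ∀ s t : S, q (f s) = q (f t) ↔ p s = p t := by
    intro s t
    rw [hq, hp, Perp, Perp, edge_map_iff, edge_map_iff, edge_coe_iff, edge_coe_iff]
  obtain ⟨i, hi⟩ : ∃ i, ∀ s : S, q (f s) = i ↔ p s = p m := by
    by_cases hm : ∃ s : S, p s = p m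
    · obtain ⟨s, hs⟩ := hm
      exact ⟨q (f s), fun t => by rw [hpq, hs]⟩
    · suffices ∃ i, ∀ s : S, q (f s) ≠ i by
        obtain ⟨i, hi⟩ := this
        exact ⟨i, fun s => iff_of_false (hi s) fun h => hm ⟨s, h⟩⟩
      by_contra! hsurj
      choose t ht using hsurj
      have hinj : Function.Injective fun i => p (t i) := by
        intro i j hij
        rw [← ht i, ← ht j]
        exact (hpq _ _).2 hij
      obtain ⟨i, hi⟩ := (Finite.injective_iff_surjective.1 hinj) (p m)
      exact hm ⟨t i, hi⟩
  obtain ⟨z, hzS, hzi, hz⟩ := hext (Set.range f) (Set.finite_range f)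
    (fun y => ∃ s : S, f s = y ∧ Edge m (s : G)) i
  have hz' : ∀ s : S, p s ≠ p m → (Edge z (f s) ↔ Edge m (s : G)) := by
    intro s hs
    rw [hz _ ⟨s, rfl⟩ (fun h => hs ((hi s).1 h))]
    constructor
    · rintro ⟨t, hts, ht⟩
      rwa [← f.injective hts]
    · exact fun h => ⟨s, rfl, h⟩
  have totH : ∀ a b : H, ¬ Perp a b → (Edge b a ↔ ¬ Edge a b) := by
    intro a b hab
    have := hH b a
    unfold Perp at hab
    tauto
  have totG : ∀ a b : G, ¬ Perp a b → (Edge b a ↔ ¬ Edge a b) := by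
    intro a b hab
    have := hG.asymm b a
    unfold Perp at hab
    tauto
  have hzl : ∀ s : S, (Edge z (f s) ↔ Edge m (s : G)) ∧ (Edge (f s) z ↔ Edge (s : G) m) := by
    intro s
    by_cases hs : p s = p m
    · have h1 := (hp _ _).1 hs
      have h2 := (hq (f s) z).1 (((hi s).2 hs).trans hzi.symm)
      unfold Perp at h1 h2
      tauto
    · have h1 : ¬ Perp m (s : G) := fun h => hs ((hp _ _).2 h).symm
      have h2 : ¬ Perp z (f s) := fun h => hs ((hi s).1 (((hq _ _).2 h).symm.trans hzi))
      exact ⟨hz' s hs, by rw [totH _ _ h2, totG _ _ h1, hz' s hs]⟩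
  have hmirr : ∀ x : G, ¬ Edge x x := fun x h => hG.asymm x x h h
  have hzirr : ∀ x : H, ¬ Edge x x := fun x h => hH x x h h
  have hT : ∀ x ∈ (Substructure.closure Language.graph {m} ⊔ S : Language.graph.Substructure G),
      x ∉ S → x = m := by
    intro x hx hxS
    have hle : Substructure.closure Language.graph {m} ⊔ S ≤
        Substructure.closure Language.graph (insert m (S : Set G)) := by
      refine sup_le (Substructure.closure_mono (by simp)) ?_
      intro y hy
      exact Substructure.subset_closure (Set.mem_insert_of_mem _ hy)
    have := hle hx
    rw [Substructure.mem_closure_iff_of_isRelational] at this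
    rcases this with h | h
    · exact h
    · exact absurd h hxS
  let g : (Substructure.closure Language.graph {m} ⊔ S : Language.graph.Substructure G) → H :=
    fun x => if h : (x : G) ∈ S then f ⟨x, h⟩ else z
  have hgS : ∀ (x : (Substructure.closure Language.graph {m} ⊔ S : Language.graph.Substructure G))
      (h : (x : G) ∈ S), g x = f ⟨x, h⟩ := fun x h => dif_pos h
  have hgN : ∀ x : (Substructure.closure Language.graph {m} ⊔ S : Language.graph.Substructure G),
      (x : G) ∉ S → g x = z := fun x h => dif_neg h
  have hg : ∀ x y, Edge (g x) (g y) ↔ Edge x y := by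
    intro x y
    rw [← edge_coe_iff]
    by_cases hx : (x : G) ∈ S <;> by_cases hy : (y : G) ∈ S
    · rw [hgS x hx, hgS y hy, edge_map_iff, ← edge_coe_iff]
    · rw [hgS x hx, hgN y hy, hT y y.2 hy]
      exact (hzl ⟨x, hx⟩).2
    · rw [hgN x hx, hgS y hy, hT x x.2 hx]
      exact (hzl ⟨y, hy⟩).1
    · rw [hgN x hx, hgN y hy, hT y y.2 hy, hT x x.2 hx]
      exact iff_of_false (hzirr _) (hmirr _)
  refine ⟨⟨⟨g, ?_⟩, fun {k} f => isEmptyElim f, ?_⟩, ?_⟩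
  · intro x y hxy
    apply Subtype.ext
    by_cases hx : (x : G) ∈ S <;> by_cases hy : (y : G) ∈ S
    · rw [hgS x hx, hgS y hy] at hxy
      exact (Subtype.mk.injEq _ _ _ _).mp (f.injective hxy)
    · rw [hgS x hx, hgN y hy] at hxy
      exact absurd ⟨_, hxy⟩ hzS
    · rw [hgN x hx, hgS y hy] at hxy
      exact absurd ⟨_, hxy.symm⟩ hzS
    · rw [hT y y.2 hy, hT x x.2 hx]
  · rintro k ⟨⟩ x
    have h := hg (x 0) (x 1)
    rw [Edge, Edge] at h
    convert h using 2 <;> funext j <;> fin_cases j <;> rfl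
  · ext x
    exact (hgS (Substructure.inclusion le_sup_right x) x.2).symm

theorem isFraisseLimit_of_extension {n : ℕ} {H : Type w} [Countable H]
    [Language.graph.Structure H] (hH : ∀ x y : H, Edge x y → ¬ Edge y x) (q : H → Fin n)
    (hq : ∀ x y, q x = q y ↔ Perp x y)
    (hext : ∀ (S : Set H), S.Finite → ∀ (f : H → Prop) (i : Fin n), ∃ z, z ∉ S ∧ q z = i ∧
      ∀ s ∈ S, q s ≠ i → (Edge z s ↔ f s)) :
    IsFraisseLimit (completePartiteClass.{w} n) H where
  ultrahomogeneous := (isUltrahomogeneous_iff_IsExtensionPair cg_of_countable).2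
    (isExtensionPair_of_extension (IsCompletePartite.of_part hH q hq) hH q hq hext)
  age := by
    ext G
    constructor
    · rintro ⟨hfg, ⟨e⟩⟩
      refine ⟨hfg.finite, IsCompletePartite.of_part (fun x y => ?_) (fun x => q (e x))
        fun x y => ?_⟩
      · rw [← edge_map_iff e, ← edge_map_iff e]
        exact hH _ _
      · rw [hq, Perp, Perp, edge_map_iff, edge_map_iff]
    · rintro ⟨hfin, hG⟩
      have : IsEmpty (Language.graph.Relations 0) := ⟨fun r => by cases r⟩
      have : IsEmpty (Language.graph.Constants) := inferInstanceAs (IsEmpty Empty)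
      obtain ⟨e, -⟩ := embedding_from_cg (L := Language.graph) (M := G) (N := H) cg_of_countable
        default (isExtensionPair_of_extension hG hH q hq hext)
      exact ⟨FG.of_finite, ⟨e⟩⟩

/-- The Fraïssé limit of the class of finite complete `n`-partite directed graphs exists, and it
has an expansion by part predicates and a convex linear order. -/
theorem exists_isFraisseLimit_isConvexPartExpansion (n : ℕ) :
    ∃ (F : Type w) (_ : Countable F) (_ : Language.graph.Structure F)
      (_ : (partOrder n).Structure F),
      IsFraisseLimit (completePartiteClass.{w} n) F ∧ IsConvexPartExpansion n F := by
  classical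
  let F := ULift.{w} (Fin n × ℕ)
  let q : F → Fin n := fun x => x.down.1
  let c : F → ℕ := fun x => Encodable.encode x.down
  have hc : Function.Injective c := Encodable.encode_injective.comp ULift.down_injective
  let r : F → F → Prop := fun x y => q x ≠ q y ∧
    (if x.down.2 < y.down.2 then Nat.testBit y.down.2 (c x) = true
      else if y.down.2 < x.down.2 then ¬ Nat.testBit x.down.2 (c y) = true else q x < q y)
  let sG : Language.graph.Structure F :=
    { funMap := fun f => isEmptyElim f
      RelMap := fun {k} R => match k, R with | _, .adj => fun x => r (x 0) (x 1) }
  let lt : F → F → Prop := fun x y => toLex x.down < toLex y.down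
  let sP : (partOrder n).Structure F :=
    { funMap := fun f => Empty.elim f
      RelMap := fun {k} R => match k, R with
        | _, .P i => fun x => q (x 0) = i
        | _, .lt => fun x => lt (x 0) (x 1) }
  have hE : ∀ x y : F, Edge x y ↔ r x y := fun x y => Iff.rfl
  have hP : ∀ (i : Fin n) (x : F), x ∈ partSet F i ↔ q x = i := fun i x => Iff.rfl
  have hlt : ∀ x y : F, orderRel n x y ↔ lt x y := fun x y => Iff.rfl
  have hasym : ∀ x y : F, Edge x y → ¬ Edge y x := by
    intro x y
    rw [hE, hE]
    rintro ⟨-, h⟩ ⟨-, h'⟩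
    rcases lt_trichotomy x.down.2 y.down.2 with h1 | h1 | h1
    · simp [h1, h1.not_gt] at h h'
      simp [h] at h'
    · simp [h1] at h h'
      exact lt_asymm h h'
    · simp [h1, h1.not_gt] at h h'
      simp [h] at h'
  have hq : ∀ x y : F, q x = q y ↔ Perp x y := by
    intro x y
    rw [Perp, hE, hE]
    constructor
    · intro h
      exact ⟨fun h' => h'.1 h, fun h' => h'.1 h.symm⟩
    · rintro ⟨h, h'⟩
      by_contra hne
      simp only [r, hne, Ne.symm hne, ne_eq, not_false_eq_true, true_and] at h h'
      rcases lt_trichotomy x.down.2 y.down.2 with h1 | h1 | h1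
      · simp [h1, h1.not_gt] at h h'
        simp [h] at h'
      · simp [h1] at h h'
        exact hne (le_antisymm h' h)
      · simp [h1, h1.not_gt] at h h'
        simp [h] at h'
  refine ⟨F, inferInstance, sG, sP, isFraisseLimit_of_extension hasym q hq ?_, ?_⟩
  · intro S hS f i
    obtain ⟨N, hN⟩ : ∃ N, ∀ s ∈ S, c s < N ∧ s.down.2 < N := by
      obtain ⟨N₁, h₁⟩ := (hS.image c).bddAbove
      obtain ⟨N₂, h₂⟩ := (hS.image fun s => s.down.2).bddAbove
      refine ⟨N₁ + N₂ + 1, fun s hs => ?_⟩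
      have := h₁ ⟨s, hs, rfl⟩
      have := h₂ ⟨s, hs, rfl⟩
      dsimp only at *
      omega
    let b : Fin (N + 1) → Bool := fun k =>
      decide ((k : ℕ) = N ∨ ∃ s ∈ S, c s = k ∧ ¬ f s)
    have hb : ∀ k (hk : k < N + 1), (Nat.ofBits b).testBit k = b ⟨k, hk⟩ := fun k hk =>
      Nat.testBit_ofBits_lt b k hk
    have hbig : N < Nat.ofBits b := by
      have h : (Nat.ofBits b).testBit N = true := by rw [hb N (by omega)]; simp [b]
      exact lt_of_lt_of_le Nat.lt_two_pow_self (Nat.ge_two_pow_of_testBit h)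
    refine ⟨⟨(i, Nat.ofBits b)⟩, fun h => ?_, rfl, fun s hs hsi => ?_⟩
    · have := (hN _ h).2
      dsimp only at this
      omega
    · rw [hE]
      have h1 := (hN s hs).2.trans hbig
      have h2 : (Nat.ofBits b).testBit (c s) = true ↔ ¬ f s := by
        rw [hb (c s) (by have := (hN s hs).1; omega)]
        simp only [b, decide_eq_true_eq]
        constructor
        · rintro (h | ⟨t, -, ht, hft⟩)
          · exact absurd h (hN s hs).1.ne
          · rwa [← hc ht]
        · exact fun h => Or.inr ⟨s, hs, rfl, h⟩
      have h3 : q ⟨(i, Nat.ofBits b)⟩ ≠ q s := fun h => hsi h.symm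
      simp only [r, h3, h1, h1.not_gt, if_false, if_true, h2, not_not, true_and, ne_eq,
        not_false_eq_true]
  · refine ⟨⟨fun i _ => ⟨⟨(i, 0)⟩, ?_⟩, fun i _ j _ hij => ?_, ?_⟩, ?_, ?_, ?_⟩
    · ext y
      rw [hP, Set.mem_ofPred_eq, ← hq]
      exact eq_comm
    · have : (⟨(i, 0)⟩ : F) ∈ partSet F j := by
        rw [← hij]
        exact rfl
      exact this
    · rintro _ ⟨x, rfl⟩
      refine ⟨q x, trivial, ?_⟩
      ext y
      rw [hP, Set.mem_ofPred_eq, ← hq]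
      exact eq_comm
    · exact { trichotomous := fun a b h h' => by
                have := le_antisymm (not_lt.1 h') (not_lt.1 h)
                exact ULift.down_injective this
              irrefl := fun a => lt_irrefl (toLex a.down)
              trans := fun a b c => lt_trans (a := toLex a.down) }
    · intro x y z h h' h''
      rw [← hq] at h'' ⊢
      rw [hlt] at h h'
      have h1 : q x ≤ q y := Prod.Lex.monotone_fst _ _ h.le
      have h2 : q y ≤ q z := Prod.Lex.monotone_fst _ _ h'.le
      exact le_antisymm h1 (h''.symm ▸ h2)
    · intro i j hij x hx y hy
      rw [hP] at hx hy
      rw [hlt]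
      refine Prod.Lex.toLex_lt_toLex.2 (Or.inl ?_)
      change q x < q y
      rwa [hx, hy]

end PartiteExpansion

/-! In an expansion of a complete partite digraph, the order between different parts is determined
by the part labels; only the order inside each part is free. So let `B` have vertex set `Fin n × Q ×
A`, where each pair `(i, q)` indexes a block that is a copy of `A` inside part `i`. An expansion of
`B` orders every block, and matching that order with the order of the expanded `A` yields a
permutation of `A`, the colour of the block.

If the edges between two blocks could be drawn with their colours known, picking one block in each
part would give a copy of the expanded `A`. The edges must be fixed before the colours are, so each
block guesses the colours of the others and edges are copied along the guesses. By
`exists_mutual_guess`, a finite `Q` and a guessing rule exist such that, for every colouring, some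
choice of one block per part makes all mutual guesses correct.
`IsLabelling.nonempty_embedding_guessDigraph` turns this choice into the embedding. -/

namespace PartiteExpansion

/-! ### Mutual guessing and finite linear orders -/

/-- Mutual guessing: against any colourings of `Q`, one for each index, one can choose an element
for each index such that every chosen element guesses (by means of `g`) the colours of all the
others. -/
theorem exists_mutual_guess (C : Type w) [Finite C] [Nonempty C] (n : ℕ) :
    ∃ (Q : Type w) (_ : Finite Q) (g : Fin n → Fin n → Q → Q → C),
      ∀ c : Fin n → Q → C, ∃ q : Fin n → Q, ∀ i j, i ≠ j → g i j (q i) (q j) = c j (q j) := by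
  obtain ⟨c₀⟩ := ‹Nonempty C›
  induction n with
  | zero =>
    exact ⟨PUnit, inferInstance, fun i => i.elim0, fun _ => ⟨fun i => i.elim0, fun i => i.elim0⟩⟩
  | succ n ih =>
    obtain ⟨Q, _, g, hg⟩ := ih
    -- A left element carries an old element and a guess for the colour at index 0; a right element,
    -- meant for index 0, is a table of guesses for left elements at the other indices. The value
    -- `c₀` fills the cases that the final choice never meets.
    let g' : Fin (n + 1) → Fin (n + 1) → (Q × C) ⊕ (Fin n → Q × C → C) →
        (Q × C) ⊕ (Fin n → Q × C → C) → C := fun i j x y =>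
      match x, y with
      | .inl x, .inl y => Fin.cases c₀ (fun i => Fin.cases c₀ (fun j => g i j x.1 y.1) j) i
      | .inl x, .inr _ => x.2
      | .inr f, .inl y => Fin.cases c₀ (fun j => f j y) j
      | .inr _, .inr _ => c₀
    refine ⟨(Q × C) ⊕ (Fin n → Q × C → C), inferInstance, g', fun c => ?_⟩
    -- No circularity: the table `f` lists the true colours of all left elements, so it is fixed
    -- before the other choices. Its own colour `e` is then known, and the others record `e` and use
    -- the induction hypothesis among themselves.
    let f : Fin n → Q × C → C := fun i x => c i.succ (.inl x)
    let e : C := c 0 (.inr f)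
    obtain ⟨q, hq⟩ := hg fun i x => f i (x, e)
    refine ⟨Fin.cases (.inr f) fun i => .inl (q i, e), fun i j => ?_⟩
    induction i using Fin.cases <;> induction j using Fin.cases
    · exact fun h => absurd rfl h
    · exact fun _ => rfl
    · exact fun _ => rfl
    · exact fun h => hq _ _ fun h' => h (congrArg Fin.succ h')

/-- Both orders are isomorphic to `Fin (Fintype.card A)`. Hence any ordering of a block amounts to a
permutation of `A`. -/
theorem nonempty_relIso_of_isStrictTotalOrder {A : Type w} [Finite A] (r s : A → A → Prop)
    (hr : IsStrictTotalOrder A r) (hs : IsStrictTotalOrder A s) : Nonempty (r ≃r s) := by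
  classical
  have := Fintype.ofFinite A
  have key : ∀ t : A → A → Prop, IsStrictTotalOrder A t →
      Nonempty (((· < ·) : Fin (Fintype.card A) → _ → Prop) ≃r t) := fun t ht =>
    ⟨@OrderIso.toRelIsoLT _ A _ (linearOrderOfSTO t).toPreorder
      (@Fintype.orderIsoFinOfCardEq A (linearOrderOfSTO t) _ _ rfl)⟩
  obtain ⟨e₁⟩ := key r hr
  obtain ⟨e₂⟩ := key s hs
  exact ⟨e₁.symm.trans e₂⟩

/-! ### Expansions in terms of colourings and orders -/

section Expansion

/-- The symbol for edges in the language of expansions. -/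
def edgeSymbol (n : ℕ) : (Language.graph.sum (partOrder n)).Relations 2 := Sum.inl adj

/-- The symbol for the `i`-th part in the language of expansions. -/
def partSymbol {n : ℕ} (i : Fin n) : (Language.graph.sum (partOrder n)).Relations 1 :=
  Sum.inr (PartOrderRel.P i)

/-- The symbol for the order in the language of expansions. -/
def orderSymbol (n : ℕ) : (Language.graph.sum (partOrder n)).Relations 2 :=
  Sum.inr PartOrderRel.lt

variable {n : ℕ} {M : Type w} [sG : Language.graph.Structure M]
  [sM : (Language.graph.sum (partOrder n)).Structure M]

/-- `p` and `r` describe the part predicates and the order of an expansion of `M`. -/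
structure IsLabelling (M : Type w) [Language.graph.Structure M]
    [(Language.graph.sum (partOrder n)).Structure M] (p : M → Fin n) (r : M → M → Prop) : Prop where
  edge : ∀ x y : M, Edge x y ↔ RelMap (edgeSymbol n) ![x, y]
  part : ∀ (i : Fin n) (x : M), p x = i ↔ RelMap (partSymbol i) ![x]
  order : ∀ x y : M, r x y ↔ RelMap (orderSymbol n) ![x, y]
  perp : ∀ x y, p x = p y ↔ Perp x y
  total : IsStrictTotalOrder M r
  lt : ∀ x y, p x < p y → r x y

theorem IsLabelling.order_iff {p : M → Fin n} {r : M → M → Prop} (h : IsLabelling M p r) {x y : M}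
    (hxy : p x ≠ p y) : r x y ↔ p x < p y := by
  refine ⟨fun hr => ?_, h.lt x y⟩
  have := h.total
  exact (lt_or_gt_of_ne hxy).resolve_right fun h' => asymm_of r hr (h.lt y x h')

/-- Labels and order are pulled back along the embedding into `F`, so that `F` is no longer needed.
-/
theorem exists_isLabelling {F : Type w'} [Language.graph.Structure F] [(partOrder n).Structure F]
    (hF : IsConvexPartExpansion n F) (hM : ∀ x : M, ¬ Edge x x)
    (hexp : (LHom.sumInl : Language.graph →ᴸ Language.graph.sum (partOrder n)).IsExpansionOn M)
    (e : M ↪[Language.graph.sum (partOrder n)] F) :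
    ∃ (p : M → Fin n) (r : M → M → Prop), IsLabelling M p r := by
  have hedge : ∀ x y : M, Edge x y ↔ RelMap (edgeSymbol n) ![x, y] := fun x y =>
    (iff_of_eq (hexp.map_onRelation adj ![x, y])).symm
  have hvec : ∀ x y : M, e ∘ ![x, y] = ![e x, e y] := fun x y => by
    funext i; fin_cases i <;> rfl
  have hedge' : ∀ x y : M, Edge (e x) (e y) ↔ Edge x y := fun x y => by
    rw [hedge, ← e.map_rel (edgeSymbol n), hvec]
    rfl
  have hlt : ∀ x y : M, orderRel n (e x) (e y) ↔ RelMap (orderSymbol n) ![x, y] :=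
    fun x y => by
      rw [← e.map_rel (orderSymbol n), hvec]
      rfl
  have hpart : ∀ (i : Fin n) (x : M), e x ∈ partSet F i ↔ RelMap (partSymbol i) ![x] :=
    fun i x => by
      have : e ∘ ![x] = ![e x] := by funext i; fin_cases i; rfl
      rw [← e.map_rel (partSymbol i), this]
      rfl
  have hlin := hF.linear
  have hex : ∀ x : M, ∃ i : Fin n, partSet F i = {y | Perp (e x) y} := fun x => by
    obtain ⟨i, -, hi⟩ := hF.parts.surjOn ⟨e x, rfl⟩
    exact ⟨i, hi⟩
  choose p hp using hex
  have hmem : ∀ x, e x ∈ partSet F (p x) := fun x => by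
    rw [hp]
    exact ⟨fun h => hM x ((hedge' x x).1 h), fun h => hM x ((hedge' x x).1 h)⟩
  have huniq : ∀ (i : Fin n) (x : M), p x = i ↔ e x ∈ partSet F i := by
    refine fun i x => ⟨fun h => h ▸ hmem x, fun h => ?_⟩
    -- A point in two different parts would precede itself by `parts_lt`.
    by_contra hne
    rcases lt_or_gt_of_ne hne with h' | h'
    · exact irrefl_of (orderRel n) _ (hF.parts_lt _ _ h' _ (hmem x) _ h)
    · exact irrefl_of (orderRel n) _ (hF.parts_lt _ _ h' _ h _ (hmem x))
  refine ⟨p, fun x y => orderRel n (e x) (e y), hedge, fun i x => (huniq i x).trans (hpart i x), hlt,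
    fun x y => ?_, ?_, fun x y h => hF.parts_lt _ _ h _ (hmem x) _ (hmem y)⟩
  · rw [eq_comm, huniq, hp]
    exact and_congr (not_congr (hedge' x y)) (not_congr (hedge' y x))
  · exact { trichotomous := fun a b h h' => e.injective (hlin.trichotomous _ _ h h')
            irrefl := fun a => irrefl_of (orderRel n) (e a)
            trans := fun a b c => trans_of (orderRel n) }

/-- Injectivity need not be assumed: distinct points are comparable under `r`, and `r'` is
irreflexive. -/
theorem IsLabelling.nonempty_embedding {N : Type w'} [Language.graph.Structure N]
    [(Language.graph.sum (partOrder n)).Structure N] {p : M → Fin n} {r : M → M → Prop}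
    (h : IsLabelling M p r) {p' : N → Fin n} {r' : N → N → Prop} (h' : IsLabelling N p' r')
    (f : M → N) (hf : ∀ x y, Edge (f x) (f y) ↔ Edge x y) (hp : ∀ x, p' (f x) = p x)
    (hr : ∀ x y, r' (f x) (f y) ↔ r x y) :
    Nonempty (M ↪[Language.graph.sum (partOrder n)] N) := by
  have hM := h.total
  have hN := h'.total
  have hvec : ∀ v : Fin 2 → M, f ∘ v = ![f (v 0), f (v 1)] := fun v => by
    funext i; fin_cases i <;> rfl
  have hvec' : ∀ v : Fin 2 → M, v = ![v 0, v 1] := fun v => by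
    funext i; fin_cases i <;> rfl
  refine ⟨⟨⟨f, fun x y hxy => ?_⟩, fun {k} f => ?_, fun {k} R v => ?_⟩⟩
  · refine hM.trichotomous x y (fun hlt => ?_) fun hlt => ?_
    · rw [← hr, hxy] at hlt
      exact irrefl_of r' _ hlt
    · rw [← hr, hxy] at hlt
      exact irrefl_of r' _ hlt
  · rcases f with f | f
    · exact isEmptyElim f
    · exact Empty.elim f
  · obtain R | R := R <;> cases R
    · change RelMap (edgeSymbol n) (f ∘ v) ↔ RelMap (edgeSymbol n) v
      rw [hvec, hvec' v]
      exact ((h'.edge _ _).symm.trans (hf _ _)).trans (h.edge _ _)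
    · rename_i i
      change RelMap (partSymbol i) (f ∘ v) ↔ RelMap (partSymbol i) v
      have h1 : f ∘ v = ![f (v 0)] := by funext i; fin_cases i; rfl
      have h2 : v = ![v 0] := by funext i; fin_cases i; rfl
      rw [h1, h2]
      exact ((h'.part _ _).symm.trans (iff_of_eq (congrArg (· = i) (hp _)))).trans (h.part _ _)
    · change RelMap (orderSymbol n) (f ∘ v) ↔ RelMap (orderSymbol n) v
      rw [hvec, hvec' v]
      exact ((h'.order _ _).symm.trans (hr _ _)).trans (h.order _ _)

end Expansion

/-! ### The digraph of guesses -/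

section Guess

variable {n : ℕ} {A Q : Type w} [Language.graph.Structure A]
  (g : Fin n → Fin n → Q → Q → Equiv.Perm A)

/-- The edges of `A` between two blocks, each copied along the permutation that the other block
guesses. -/
def guessRel (u v : Fin n × Q × A) : Prop :=
  Edge (g v.1 u.1 v.2.1 u.2.1 u.2.2) (g u.1 v.1 u.2.1 v.2.1 v.2.2)

/-- The complete `n`-partite directed graph with parts `{i} × Q × A` in which the edges between
different parts are given by `guessRel`. -/
@[reducible]
def guessDigraph : Language.graph.Structure (Fin n × Q × A) where
  funMap := fun f => isEmptyElim f
  RelMap := fun {k} R => match k, R with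
    | _, .adj => fun x : Fin 2 → Fin n × Q × A => ((x 0).1 < (x 1).1 ∧ guessRel g (x 0) (x 1)) ∨
        ((x 1).1 < (x 0).1 ∧ ¬ guessRel g (x 1) (x 0))

theorem edge_guessDigraph (u v : Fin n × Q × A) :
    @Edge _ (guessDigraph g) u v ↔
      (u.1 < v.1 ∧ guessRel g u v) ∨ (v.1 < u.1 ∧ ¬ guessRel g v u) := Iff.rfl

/-- Holds however bad the guesses are: for two different parts `guessRel` is consulted in one
direction only, and the other direction is its negation. -/
theorem edge_guessDigraph_asymm (u v : Fin n × Q × A) (h : @Edge _ (guessDigraph g) u v) :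
    ¬ @Edge _ (guessDigraph g) v u := by
  rw [edge_guessDigraph] at h ⊢
  rcases lt_trichotomy u.1 v.1 with h' | h' | h'
  · simp_all [h'.not_gt]
  · simp_all
  · simp_all [h'.not_gt]

theorem perp_guessDigraph (u v : Fin n × Q × A) :
    u.1 = v.1 ↔ @Perp _ (guessDigraph g) u v := by
  let := guessDigraph g
  rw [Perp, edge_guessDigraph, edge_guessDigraph]
  rcases lt_trichotomy u.1 v.1 with h' | h' | h'
  · simp [h', h'.ne, h'.not_gt]
  · simp [h']
  · simp [h', h'.ne', h'.not_gt]

end Guess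

/-! ### Embedding through correctly guessing blocks -/

/-- An expansion of `A` embeds in an expansion of the digraph of guesses, if the guesses defeat all
colourings. -/
theorem IsLabelling.nonempty_embedding_guessDigraph {n : ℕ} {A Q : Type w} [Finite A]
    [Language.graph.Structure A] [(Language.graph.sum (partOrder n)).Structure A]
    (hA : ∀ x y : A, Edge x y → ¬ Edge y x) {g : Fin n → Fin n → Q → Q → Equiv.Perm A}
    (hg : ∀ c : Fin n → Q → Equiv.Perm A, ∃ q : Fin n → Q, ∀ i j, i ≠ j →
      g i j (q i) (q j) = c j (q j))
    [sB : (Language.graph.sum (partOrder n)).Structure (Fin n × Q × A)]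
    {p : A → Fin n} {r : A → A → Prop} (h : IsLabelling A p r)
    {p' : Fin n × Q × A → Fin n} {r' : Fin n × Q × A → Fin n × Q × A → Prop}
    (h' : @IsLabelling n (Fin n × Q × A) (guessDigraph g) sB p' r') :
    Nonempty (A ↪[Language.graph.sum (partOrder n)] (Fin n × Q × A)) := by
  let := guessDigraph g
  rcases isEmpty_or_nonempty A with hE | ⟨⟨x₀⟩⟩
  · exact h.nonempty_embedding h' isEmptyElim isEmptyElim isEmptyElim isEmptyElim
  have hr' := h'.total
  have hc : ∀ i q, Nonempty ((fun x y => r' (i, q, x) (i, q, y)) ≃r r) := fun i q =>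
    nonempty_relIso_of_isStrictTotalOrder _ _
      { trichotomous := fun a b h h' => by
          have := hr'.trichotomous _ _ h h'
          simpa using this
        irrefl := fun a => irrefl_of r' (i, q, a)
        trans := fun a b c => trans_of r' } h.total
  let c : ∀ i q, (fun x y => r' (i, q, x) (i, q, y)) ≃r r := fun i q => (hc i q).some
  obtain ⟨q, hq⟩ := hg fun i x => (c i x).toEquiv
  have hp' : ∀ u v, p' u = p' v ↔ u.1 = v.1 := fun u v =>
    (h'.perp u v).trans (perp_guessDigraph g u v).symm
  -- The expansion may label the parts of the digraph in any order; `π` inverts that labelling. One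
  -- representative per part shows it is injective, hence surjective, on `Fin n`.
  obtain ⟨π, hπ⟩ : ∃ π : Fin n → Fin n,
      ∀ (i : Fin n) (u : Fin n × Q × A), u.1 = π i → p' u = i := by
    have hinj : Function.Injective fun i => p' (i, q i, x₀) := fun i j hij => (hp' _ _).1 hij
    have hsurj := Finite.injective_iff_surjective.1 hinj
    choose π hπ using hsurj
    exact ⟨π, fun i u hu => ((hp' u _).2 hu).trans (hπ i)⟩
  let f : A → Fin n × Q × A := fun x => (π (p x), q (π (p x)), (c (π (p x)) (q (π (p x)))).symm x)
  have hfp : ∀ x, p' (f x) = p x := fun x => hπ _ _ rfl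
  have hfe : ∀ x y, (f x).1 = (f y).1 ↔ p x = p y := fun x y => by rw [← hp', hfp, hfp]
  have hrel : ∀ x y, p x ≠ p y → (guessRel g (f x) (f y) ↔ Edge x y) := fun x y hxy => by
    have hne : π (p x) ≠ π (p y) := fun h => hxy ((hfe x y).1 h)
    simp only [guessRel, f]
    -- Both guesses are correct, so each permutation undoes the inverse used in `f`.
    rw [hq _ _ hne, hq _ _ hne.symm]
    exact iff_of_eq (congrArg₂ Edge ((c _ _).apply_symm_apply x) ((c _ _).apply_symm_apply y))
  refine h.nonempty_embedding h' f (fun x y => ?_) hfp fun x y => ?_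
  · by_cases hxy : p x = p y
    · have h1 := (perp_guessDigraph g _ _).1 ((hfe x y).2 hxy)
      exact iff_of_false h1.1 ((h.perp x y).1 hxy).1
    · have hne : (f x).1 ≠ (f y).1 := fun h => hxy ((hfe x y).1 h)
      have h1 := hA x y
      have h2 : ¬ (¬ Edge x y ∧ ¬ Edge y x) := fun h2 => hxy ((h.perp x y).2 h2)
      rw [edge_guessDigraph, hrel x y hxy, hrel y x (Ne.symm hxy)]
      rcases lt_or_gt_of_ne hne with hlt | hlt
      · simp [hlt, hlt.not_gt]
      -- Here the edge is a negated one; between different parts of `A`, the negation of an edge is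
      -- the reverse edge.
      · simp only [hlt, hlt.not_gt, false_and, true_and, false_or]
        tauto
  · by_cases hxy : p x = p y
    -- Points of one part of `A` land in a single block, on which `c` is an order isomorphism; the
    -- equality of indices is substituted first to make this visible.
    · have key : ∀ i j, i = j → (r' (i, q i, (c i (q i)).symm x) (j, q j, (c j (q j)).symm y) ↔
          r x y) := by
        rintro i _ rfl
        exact (c i (q i)).symm.map_rel_iff
      exact key _ _ (congrArg π hxy)
    · rw [h.order_iff hxy, h'.order_iff (by rwa [hfp, hfp]), hfp, hfp]

end PartiteExpansion

/-- Let `F` be the Fraïssé limit of the class of finite complete `n`-partite directed graphs,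
expanded by unary predicates for its parts and a convex linear order `<` with
`P 0 < ⋯ < P (n - 1)`. The age of the expansion has the expansion property relative to the age
of `F`. -/
theorem mainTheorem8 (n : ℕ) (F : Type w) [Countable F] [Language.graph.Structure F]
    (hF : IsFraisseLimit (PartiteExpansion.completePartiteClass.{w} n) F)
    [(PartiteExpansion.partOrder n).Structure F]
    (hFstar : PartiteExpansion.IsConvexPartExpansion n F) :
    PartiteExpansion.HasExpansionProperty
      (LHom.sumInl : Language.graph →ᴸ Language.graph.sum (PartiteExpansion.partOrder n))
      ((Language.graph.sum (PartiteExpansion.partOrder n)).age F)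
      (Language.graph.age F) := by
  open PartiteExpansion in
  intro A hA
  rw [hF.age] at hA
  obtain ⟨hfin, hA⟩ := hA
  have : Finite A := hfin
  obtain ⟨Q, _, g, hg⟩ := exists_mutual_guess (Equiv.Perm A) n
  refine ⟨⟨Fin n × Q × A, guessDigraph g⟩, ?_, fun sA sB hsA hsB hA' hB' => ?_⟩
  · rw [hF.age]
    let := guessDigraph g
    exact ⟨inferInstanceAs (Finite (Fin n × Q × A)),
      IsCompletePartite.of_part (edge_guessDigraph_asymm g) Prod.fst (perp_guessDigraph g)⟩
  · obtain ⟨-, ⟨eA⟩⟩ := hA'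
    obtain ⟨-, ⟨eB⟩⟩ := hB'
    obtain ⟨p, r, h⟩ := exists_isLabelling hFstar (fun x h => hA.asymm x x h h) hsA eA
    let := guessDigraph g
    obtain ⟨p', r', h'⟩ := exists_isLabelling hFstar
      (fun x h => edge_guessDigraph_asymm g x x h h) hsB eB
    exact h.nonempty_embedding_guessDigraph hA.asymm hg h'
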